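/- Let $(\Omega,\mathcal F,\mathbb Q)$ be a probability space, $m>0$ and $T>0$. A standard gamma process with growth rate $m$ is a process $\{\gamma_t\}_{t\ge 0}$ with independent increments, with $\gamma_0=0$, and such that for each $t>0$ the random variable $\gamma_t$ has density $x^{mt-1}e^{-x}/\Gamma(mt)$ on $x>0$; a standard gamma bridge over $[0,T]$ with parameter $m$ is any process $\{\gamma_{tT}\}_{0\le t\le T}$ having the law of $\{\gamma_t/\gamma_T\}_{0\le t\le T}$ for such a process $\{\gamma_t\}$. Let $\{\gamma_{tT}\}_{0\le t\le T}$ be a standard gamma bridge over $[0,T]$ with parameter $m$ on $(\Omega,\mathcal F,\mathbb Q)$, and let $X_T$ be a strictly positive random variable that is independent of the process $\{\gamma_{tT}\}_{0\le t\le T}$. Define the aggregate claims process by $\xi_t=X_T\gamma_{tT}$ for $0\le t\le T$, and let $\mathcal F_t=\sigma(\{\xi_u\}_{0\le u\le t})$. (Equalities and inequalities between random variables are understood almost surely.) Then $\{\xi_t\}_{0\le t\le T}$ has the Markov property with respect to $\{\mathcal F_t\}$: for all $0\le s\le t\le T$ and every Borel set $B\subseteq\mathbb R$, $$\mathbb Q[\xi_t\in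 B\mid\mathcal F_s]=\mathbb Q[\xi_t\in B\mid\xi_s]\quad\text{almost surely.}$$ -/

import Mathlib

open MeasureTheory ProbabilityTheory
open scoped NNReal

/-- A standard gamma process with growth rate `m` on the probability space `(Ω, P)`: a real-valued
process `(γ_t)_{t ≥ 0}` with independent increments, `γ_0 = 0` almost surely, and such that for
`t > 0` the random variable `γ_t` has density `x ^ (m t - 1) e ^ (-x) / Γ(m t)` on `x > 0`. -/
structure IsStandardGammaProcess {Ω : Type*} [MeasurableSpace Ω] (m : ℝ) (γ : ℝ≥0 → Ω → ℝ)
    (P : Measure Ω) : Prop where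
  measurable : ∀ t, Measurable (γ t)
  indepIncrements : HasIndepIncrements γ P
  zero : ∀ᵐ ω ∂P, γ 0 ω = 0
  law : ∀ t : ℝ≥0, 0 < t → HasLaw (γ t) (gammaMeasure (m * t) 1) P

/-- A standard gamma bridge over `[0, T]` with parameter `m`: any process indexed by `[0, T]` that
has the law (on the product space of paths) of `(γ_t / γ_T)_{0 ≤ t ≤ T}`, where `γ` is a standard
gamma process with growth rate `m`, on a possibly different probability space. -/
structure IsStandardGammaBridge {Ω : Type*} [MeasurableSpace Ω] (m : ℝ) (T : ℝ≥0)
    (Y : Set.Icc (0 : ℝ≥0) T → Ω → ℝ) (P : Measure Ω) : Prop where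
  measurable : ∀ t, Measurable (Y t)
  law : ∃ (Ω' : Type) (_ : MeasurableSpace Ω') (P' : Measure Ω') (γ : ℝ≥0 → Ω' → ℝ),
    IsProbabilityMeasure P' ∧ IsStandardGammaProcess m γ P' ∧
      IdentDistrib (fun ω t ↦ Y t ω)
        (fun ω (t : Set.Icc (0 : ℝ≥0) T) ↦ γ (t : ℝ≥0) ω / γ T ω) P P'

/-- The (elementary) Markov property of the real-valued process `ξ` with respect to the filtration
`ℱ`: `ξ` is adapted, and for all `s ≤ t` and all Borel sets `B`, almost surely
`P[ξ_t ∈ B | ℱ_s] = P[ξ_t ∈ B | ξ_s]`. -/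
structure HasMarkovProperty {Ω ι : Type*} [mΩ : MeasurableSpace Ω] [Preorder ι]
    (ξ : ι → Ω → ℝ) (ℱ : Filtration ι mΩ) (P : Measure Ω) : Prop where
  adapted : ∀ t, Measurable[ℱ t] (ξ t)
  markov : ∀ s t, s ≤ t → ∀ B : Set ℝ, MeasurableSet B →
    P⟦ξ t ⁻¹' B | ℱ s⟧ =ᵐ[P] P⟦ξ t ⁻¹' B | MeasurableSpace.comap (ξ s) inferInstance⟧

/-! For `s > 0` the past of `ξ` up to `s` is generated, up to null sets, by `ξ_s` and the ratios
`ξ_u / ξ_s`, `u ≤ s`. Both `X_T` and `γ_T` cancel in these ratios, which thus have the law of `γ_u /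
γ_s`. They are independent of `(ξ_s, ξ_t)`, so conditioning on them in addition to `ξ_s` changes
nothing (`condExp_iSup_comap_ae_eq_of_indepFun`).

The independence is Lukacs' theorem (`indepFun_sum_of_scale_invariant`): ratios of independent gamma
variables are independent of their sum `γ_s`. Tilting the joint law by `exp (θ * sum)` only rescales
it, and a scale-invariant event does not notice rescaling. Hence restricting to that event
multiplies the moment generating function of the sum by a constant. The increments after `s`, and
then `X_T`, are adjoined by `IndepFun.prodMk_of_indepFun_prodMk`. -/

open scoped ENNReal Topology

/-! ### Exponential moments and tilting on the line -/

/-- Finite measures on `ℝ` whose moment generating functions are finite and agree in a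
neighbourhood of `0` are equal. -/
lemma MeasureTheory.Measure.ext_of_lintegral_exp_eq {μ ν : Measure ℝ} {ε : ℝ} (hε : 0 < ε)
    (hfin : ∀ t, |t| < ε → ∫⁻ x, ENNReal.ofReal (Real.exp (t * x)) ∂μ ≠ ∞)
    (heq : ∀ t, |t| < ε → ∫⁻ x, ENNReal.ofReal (Real.exp (t * x)) ∂μ =
      ∫⁻ x, ENNReal.ofReal (Real.exp (t * x)) ∂ν) :
    μ = ν := by
  have hint : ∀ κ : Measure ℝ, (∀ t, |t| < ε →
      ∫⁻ x, ENNReal.ofReal (Real.exp (t * x)) ∂κ ≠ ∞) →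
      IsFiniteMeasure κ ∧ Set.Ioo (-ε) ε ⊆ interior (integrableExpSet id κ) := by
    intro κ h
    refine ⟨⟨by simpa [lt_top_iff_ne_top] using h 0 (by simpa using hε)⟩,
      interior_maximal (fun t ht ↦ ?_) isOpen_Ioo⟩
    refine ⟨by fun_prop, ?_⟩
    rw [hasFiniteIntegral_iff_ofReal (Filter.Eventually.of_forall fun x ↦ (Real.exp_pos _).le)]
    exact (h t (abs_lt.2 ht)).lt_top
  obtain ⟨_, hμ⟩ := hint μ hfin
  obtain ⟨_, hν⟩ := hint ν fun t ht ↦ heq t ht ▸ hfin t ht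
  have hsub (κ : Measure ℝ) (h : Set.Ioo (-ε) ε ⊆ interior (integrableExpSet id κ)) :
      AnalyticOnNhd ℂ (complexMGF id κ) (Complex.re ⁻¹' Set.Ioo (-ε) ε) :=
    analyticOnNhd_complexMGF.mono fun z hz ↦ h hz
  have hreal : ∀ t : ℝ, |t| < ε → complexMGF id μ t = complexMGF id ν t := by
    intro t ht
    rw [complexMGF_ofReal, complexMGF_ofReal, mgf, mgf,
      integral_eq_lintegral_of_nonneg_ae
        (Filter.Eventually.of_forall fun x ↦ (Real.exp_pos _).le) (by fun_prop),
      integral_eq_lintegral_of_nonneg_ae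
        (Filter.Eventually.of_forall fun x ↦ (Real.exp_pos _).le) (by fun_prop)]
    simp [heq t ht]
  -- The real axis accumulates at `0`, so agreement there is enough for the identity theorem on the
  -- strip `|Re z| < ε`, which contains the imaginary axis and so determines the characteristic
  -- functions.
  have hfreq : ∃ᶠ z in 𝓝[≠] (0 : ℂ), complexMGF id μ z = complexMGF id ν z := by
    have hev : ∀ᶠ x : ℝ in 𝓝[≠] (0 : ℝ), complexMGF id μ x = complexMGF id ν x := by
      refine Filter.Eventually.filter_mono nhdsWithin_le_nhds ?_
      filter_upwards [Ioo_mem_nhds (neg_lt_zero.2 hε) hε] with x hx using hreal x (abs_lt.2 hx)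
    have htend : Filter.Tendsto (fun x : ℝ ↦ (x : ℂ)) (𝓝[≠] 0) (𝓝[≠] 0) := by
      refine tendsto_nhdsWithin_iff.2 ⟨?_, ?_⟩
      · exact (Complex.continuous_ofReal.tendsto' 0 0 (by simp)).mono_left nhdsWithin_le_nhds
      · filter_upwards [self_mem_nhdsWithin] with x hx using by simpa using hx
    exact htend.frequently hev.frequently
  have hstrip := (hsub μ hμ).eqOn_of_preconnected_of_frequently_eq (hsub ν hν)
    ((convex_Ioo (-ε) ε).linear_preimage Complex.reLm).isPreconnected
    (z₀ := 0) (by simpa using hε) hfreq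
  refine Measure.ext_of_charFun (funext fun t ↦ ?_)
  rw [← Measure.map_id (μ := μ), ← Measure.map_id (μ := ν), ← complexMGF_mul_I aemeasurable_id,
    ← complexMGF_mul_I aemeasurable_id]
  exact hstrip (by simpa using hε)

lemma lintegral_exp_mul_gammaMeasure {a t : ℝ} (ha : 0 < a) (ht : t < 1) :
    ∫⁻ x, ENNReal.ofReal (Real.exp (t * x)) ∂(gammaMeasure a 1) =
      ENNReal.ofReal ((1 - t) ^ (-a)) := by
  have h1 : 0 < 1 - t := by linarith
  rw [gammaMeasure, lintegral_withDensity_eq_lintegral_mul _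
    (by exact (measurable_gammaPDFReal a 1).ennreal_ofReal) (by fun_prop)]
  have key : ∀ x, (gammaPDF a 1 * fun x ↦ ENNReal.ofReal (Real.exp (t * x))) x =
      ENNReal.ofReal ((1 - t) ^ (-a)) * gammaPDF a (1 - t) x := by
    intro x
    rw [Pi.mul_apply, gammaPDF, gammaPDF, ← ENNReal.ofReal_mul (gammaPDFReal_nonneg ha one_pos x),
      ← ENNReal.ofReal_mul (by positivity)]
    congr 1
    simp only [gammaPDFReal]
    split_ifs with hx
    · have h2 : Real.exp (-(1 * x)) * Real.exp (t * x) = Real.exp (-((1 - t) * x)) := by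
        rw [← Real.exp_add]; ring_nf
      have h3 : (1 - t) ^ (-a) * (1 - t) ^ a = 1 := by
        rw [← Real.rpow_add h1]; simp
      rw [Real.one_rpow, mul_assoc, h2]
      linear_combination (-(1 / Real.Gamma a * x ^ (a - 1) * Real.exp (-((1 - t) * x)))) * h3
    · simp
  simp_rw [key]
  rw [lintegral_const_mul _ (by exact (measurable_gammaPDFReal a _).ennreal_ofReal),
    lintegral_gammaPDF_eq_one ha h1, mul_one]

/-- If `μ` has the moment generating function of a gamma distribution, then tilting `μ`
exponentially amounts to rescaling it. -/
lemma withDensity_exp_eq_smul_map {μ : Measure ℝ} {b : ℝ}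
    (hμ : ∀ t < 1, ∫⁻ x, ENNReal.ofReal (Real.exp (t * x)) ∂μ = ENNReal.ofReal ((1 - t) ^ (-b)))
    {θ : ℝ} (hθ : θ < 1) :
    μ.withDensity (fun x ↦ ENNReal.ofReal (Real.exp (θ * x))) =
      ENNReal.ofReal ((1 - θ) ^ (-b)) • μ.map (fun x ↦ (1 - θ)⁻¹ * x) := by
  have h1 : 0 < 1 - θ := by linarith
  -- Tilting by `θ` shifts the argument of the moment generating function to `θ + t`, and `1 - (θ +
  -- t) = (1 - θ) * (1 - t / (1 - θ))` splits off the mass and the rescaling.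
  have hL : ∀ t, |t| < 1 - θ → ∫⁻ x, ENNReal.ofReal (Real.exp (t * x))
      ∂(μ.withDensity (fun x ↦ ENNReal.ofReal (Real.exp (θ * x)))) =
        ENNReal.ofReal ((1 - (θ + t)) ^ (-b)) := by
    intro t ht
    rw [lintegral_withDensity_eq_lintegral_mul _ (by fun_prop) (by fun_prop),
      ← hμ _ (by linarith [(abs_lt.1 ht).2])]
    refine lintegral_congr fun x ↦ ?_
    rw [Pi.mul_apply, ← ENNReal.ofReal_mul (Real.exp_pos _).le, ← Real.exp_add, add_mul]
  refine Measure.ext_of_lintegral_exp_eq h1 (fun t ht ↦ by simp [hL t ht]) fun t ht ↦ ?_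
  have ht' : (1 - θ)⁻¹ * t < 1 := by
    rw [inv_mul_lt_iff₀ h1]; linarith [(abs_lt.1 ht).2]
  rw [hL t ht, lintegral_smul_measure, lintegral_map (by fun_prop) (by fun_prop)]
  have : ∀ x, t * ((1 - θ)⁻¹ * x) = (1 - θ)⁻¹ * t * x := fun x ↦ by ring
  simp_rw [this]
  rw [hμ _ ht', smul_eq_mul, ← ENNReal.ofReal_mul (by positivity),
    ← Real.mul_rpow h1.le (by linarith)]
  congr 2
  field_simp
  ring

/-! ### Adjoining an independent variable -/

section Indep

variable {Ω α β γ : Type*} {mΩ : MeasurableSpace Ω} {P : Measure Ω} [MeasurableSpace α]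
  [MeasurableSpace β] [MeasurableSpace γ]

/-- The probability of a triple rectangle factors by splitting off `X` first and then separating `R`
from `W`; rectangles determine the joint law. -/
lemma ProbabilityTheory.IndepFun.prodMk_of_indepFun_prodMk [IsProbabilityMeasure P]
    {R : Ω → α} {X : Ω → β} {W : Ω → γ}
    (hR : Measurable R) (hX : Measurable X) (hW : Measurable W) (hRW : IndepFun R W P)
    (hXRW : IndepFun X (fun ω ↦ (R ω, W ω)) P) :
    IndepFun R (fun ω ↦ (X ω, W ω)) P := by
  have hXW : IndepFun X W P := hXRW.comp measurable_id measurable_snd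
  rw [indepFun_iff_map_prod_eq_prod_map_map (by fun_prop) (by fun_prop),
    (indepFun_iff_map_prod_eq_prod_map_map (by fun_prop) (by fun_prop)).1 hXW]
  have := Measure.isProbabilityMeasure_map (μ := P) hX.aemeasurable
  have := Measure.isProbabilityMeasure_map (μ := P) hW.aemeasurable
  refine Measure.ext_prod₃ fun {s t u} hs ht hu ↦ ?_
  rw [Measure.map_apply (by fun_prop) (hs.prod (ht.prod hu)), Measure.prod_prod,
    Measure.prod_prod, Measure.map_apply hR hs, Measure.map_apply hX ht, Measure.map_apply hW hu]
  have h1 := indepFun_iff_measure_inter_preimage_eq_mul.1 hXRW t (s ×ˢ u) ht (hs.prod hu)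
  have h2 := indepFun_iff_measure_inter_preimage_eq_mul.1 hRW s u hs hu
  have e1 : (fun ω ↦ (R ω, X ω, W ω)) ⁻¹' s ×ˢ t ×ˢ u =
      X ⁻¹' t ∩ (fun ω ↦ (R ω, W ω)) ⁻¹' s ×ˢ u := by ext; simp; tauto
  have e2 : (fun ω ↦ (R ω, W ω)) ⁻¹' s ×ˢ u = R ⁻¹' s ∩ W ⁻¹' u := by ext; simp
  rw [e1, h1, e2, h2]
  ring

end Indep

/-! ### Lukacs' theorem by exponential tilting -/

section Tilt

variable {Ω ι : Type*} {mΩ : MeasurableSpace Ω} {P : Measure Ω} [IsProbabilityMeasure P]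
  [Fintype ι] {D : ι → Ω → ℝ} {b : ι → ℝ}

/-- Tilting the joint law of independent gamma variables by the exponential of their sum amounts to
rescaling all of them. -/
lemma map_withDensity_prod_exp_eq (hD : ∀ i, Measurable (D i)) (hind : iIndepFun D P)
    (hexp : ∀ i, ∀ t < 1, ∫⁻ ω, ENNReal.ofReal (Real.exp (t * D i ω)) ∂P =
      ENNReal.ofReal ((1 - t) ^ (-(b i)))) {θ : ℝ} (hθ : θ < 1) :
    (P.withDensity (fun ω ↦ ∏ i, ENNReal.ofReal (Real.exp (θ * D i ω)))).map
        (fun ω i ↦ D i ω) =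
      (∏ i, ENNReal.ofReal ((1 - θ) ^ (-(b i)))) •
        P.map (fun ω i ↦ (1 - θ)⁻¹ * D i ω) := by
  set c : ι → ℝ≥0∞ := fun i ↦ ENNReal.ofReal ((1 - θ) ^ (-(b i)))
  have htilt : ∀ i, (P.map (D i)).withDensity (fun x ↦ ENNReal.ofReal (Real.exp (θ * x))) =
      c i • (P.map (D i)).map (fun x ↦ (1 - θ)⁻¹ * x) := fun i ↦
    withDensity_exp_eq_smul_map (fun t ht ↦ by
      rw [lintegral_map (by fun_prop) (hD i), hexp i t ht]) hθ
  have hfin : ∀ i, IsFiniteMeasure (c i • (P.map (D i)).map (fun x ↦ (1 - θ)⁻¹ * x)) := fun i ↦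
    Measure.smul_finite _ ENNReal.ofReal_ne_top
  trans Measure.pi fun i ↦ c i • (P.map (D i)).map (fun x ↦ (1 - θ)⁻¹ * x)
  · refine (Measure.pi_eq fun s hs ↦ ?_).symm
    have hms : MeasurableSet ((fun ω i ↦ D i ω) ⁻¹' Set.univ.pi s) :=
      (measurable_pi_lambda _ hD) (MeasurableSet.univ_pi hs)
    rw [Measure.map_apply (measurable_pi_lambda _ hD) (MeasurableSet.univ_pi hs),
      withDensity_apply _ hms, ← lintegral_indicator hms]
    have hprod : ∀ ω, ((fun ω i ↦ D i ω) ⁻¹' Set.univ.pi s).indicator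
        (fun ω ↦ ∏ i, ENNReal.ofReal (Real.exp (θ * D i ω))) ω =
        ∏ i, (s i).indicator (fun x ↦ ENNReal.ofReal (Real.exp (θ * x))) (D i ω) := by
      intro ω
      by_cases h : ∀ i, D i ω ∈ s i
      · rw [Set.indicator_of_mem (by simpa using h)]
        exact Finset.prod_congr rfl fun i _ ↦ by rw [Set.indicator_of_mem (h i)]
      · rw [Set.indicator_of_notMem (by simpa using h)]
        obtain ⟨i, hi⟩ := not_forall.1 h
        exact (Finset.prod_eq_zero (Finset.mem_univ i) (by simp [hi])).symm
    have hm : ∀ i, Measurable ((s i).indicator (fun x ↦ ENNReal.ofReal (Real.exp (θ * x)))) :=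
      fun i ↦ Measurable.indicator (by fun_prop) (hs i)
    simp_rw [hprod]
    rw [lintegral_prod_eq_prod_lintegral_of_indepFun Finset.univ
      (fun i ω ↦ (s i).indicator (fun x ↦ ENNReal.ofReal (Real.exp (θ * x))) (D i ω))
      (hind.comp _ hm) fun i ↦ (hm i).comp (hD i)]
    refine Finset.prod_congr rfl fun i _ ↦ ?_
    rw [← htilt i, withDensity_apply _ (hs i), ← lintegral_indicator (hs i),
      lintegral_map (hm i) (hD i)]
  · refine Measure.pi_eq fun s hs ↦ ?_
    have hs' : ∀ i, MeasurableSet ((fun x ↦ (1 - θ)⁻¹ * x) ⁻¹' s i) := fun i ↦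
      (hs i).preimage (by fun_prop)
    rw [Measure.smul_apply, smul_eq_mul,
      Measure.map_apply (by fun_prop) (MeasurableSet.univ_pi hs)]
    have e : (fun ω i ↦ (1 - θ)⁻¹ * D i ω) ⁻¹' Set.univ.pi s =
        ⋂ i ∈ Finset.univ, D i ⁻¹' ((fun x ↦ (1 - θ)⁻¹ * x) ⁻¹' s i) := by
      ext; simp
    rw [e, hind.measure_inter_preimage_eq_mul Finset.univ fun i _ ↦ hs' i,
      ← Finset.prod_mul_distrib]
    refine Finset.prod_congr rfl fun i _ ↦ ?_
    rw [Measure.smul_apply, smul_eq_mul, Measure.map_apply (by fun_prop) (hs i),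
      Measure.map_apply (hD i) (hs' i)]

/-- A scale-invariant function of independent gamma variables is independent of their sum. -/
theorem indepFun_sum_of_scale_invariant {E : Type*} [MeasurableSpace E]
    (hD : ∀ i, Measurable (D i)) (hind : iIndepFun D P)
    (hexp : ∀ i, ∀ t < 1, ∫⁻ ω, ENNReal.ofReal (Real.exp (t * D i ω)) ∂P =
      ENNReal.ofReal ((1 - t) ^ (-(b i))))
    {Φ : (ι → ℝ) → E} (hΦ : Measurable Φ)
    (hscale : ∀ k : ℝ, 0 < k → ∀ x, Φ (fun i ↦ k * x i) = Φ x) :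
    IndepFun (fun ω ↦ Φ (fun i ↦ D i ω)) (fun ω ↦ ∑ i, D i ω) P := by
  have hDm : Measurable (fun ω i ↦ D i ω) := measurable_pi_lambda _ hD
  have hS : Measurable (fun ω ↦ ∑ i, D i ω) := by fun_prop
  have hΦD : Measurable (fun ω ↦ Φ (fun i ↦ D i ω)) := hΦ.comp hDm
  have htilt : ∀ C : Set E, MeasurableSet C → ∀ θ < 1,
      ∫⁻ x, ENNReal.ofReal (Real.exp (θ * x))
        ∂((P.restrict ((fun ω ↦ Φ (fun i ↦ D i ω)) ⁻¹' C)).map (fun ω ↦ ∑ i, D i ω)) =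
      (∏ i, ENNReal.ofReal ((1 - θ) ^ (-(b i)))) *
        P ((fun ω ↦ Φ (fun i ↦ D i ω)) ⁻¹' C) := by
    intro C hC θ hθ
    have h := congrArg (fun μ ↦ μ (Φ ⁻¹' C)) (map_withDensity_prod_exp_eq hD hind hexp hθ)
    simp only [Measure.smul_apply, smul_eq_mul] at h
    rw [Measure.map_apply hDm (hΦ hC), withDensity_apply _ (hDm (hΦ hC)),
      Measure.map_apply (by fun_prop) (hΦ hC)] at h
    have e : (fun ω i ↦ (1 - θ)⁻¹ * D i ω) ⁻¹' (Φ ⁻¹' C) =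
        (fun ω ↦ Φ (fun i ↦ D i ω)) ⁻¹' C := by
      ext ω
      simp [hscale (1 - θ)⁻¹ (inv_pos.2 (by linarith)) (fun i ↦ D i ω)]
    rw [e] at h
    rw [lintegral_map (by fun_prop) hS, ← h]
    refine lintegral_congr fun ω ↦ ?_
    rw [← ENNReal.ofReal_prod_of_nonneg fun i _ ↦ (Real.exp_pos _).le, ← Real.exp_sum,
      Finset.mul_sum]
  refine indepFun_iff_measure_inter_preimage_eq_mul.2 fun C A hC hA ↦ ?_
  have hne : ∀ θ : ℝ, (∏ i, ENNReal.ofReal ((1 - θ) ^ (-(b i)))) ≠ ∞ := fun θ ↦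
    ENNReal.prod_ne_top fun i _ ↦ ENNReal.ofReal_ne_top
  have hmeas : (P.restrict ((fun ω ↦ Φ (fun i ↦ D i ω)) ⁻¹' C)).map (fun ω ↦ ∑ i, D i ω) =
      P ((fun ω ↦ Φ (fun i ↦ D i ω)) ⁻¹' C) • P.map (fun ω ↦ ∑ i, D i ω) := by
    refine Measure.ext_of_lintegral_exp_eq one_pos (fun θ hθ ↦ ?_) fun θ hθ ↦ ?_
    · rw [htilt C hC θ (abs_lt.1 hθ).2]
      exact ENNReal.mul_ne_top (hne θ) (measure_ne_top _ _)
    -- The case `C = univ` identifies the product of constants as the moment generating function of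
    -- the sum.
    · have hu := htilt Set.univ MeasurableSet.univ θ (abs_lt.1 hθ).2
      simp only [Set.preimage_univ, Measure.restrict_univ, measure_univ, mul_one] at hu
      rw [htilt C hC θ (abs_lt.1 hθ).2, lintegral_smul_measure, hu, smul_eq_mul, mul_comm]
  have h := congrArg (fun μ ↦ μ A) hmeas
  simp only [Measure.smul_apply, smul_eq_mul] at h
  rw [Measure.map_apply hS hA, Measure.restrict_apply (hS hA), Measure.map_apply hS hA] at h
  rw [Set.inter_comm, h]

end Tilt

/-! ### Gamma processes -/

namespace IsStandardGammaProcess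

variable {Ω : Type*} {mΩ : MeasurableSpace Ω} {P : Measure Ω} [IsProbabilityMeasure P]
  {m : ℝ} {γ : ℝ≥0 → Ω → ℝ}

lemma lintegral_exp_mul (hγ : IsStandardGammaProcess m γ P) (hm : 0 < m) (t : ℝ≥0) {θ : ℝ}
    (hθ : θ < 1) :
    ∫⁻ ω, ENNReal.ofReal (Real.exp (θ * γ t ω)) ∂P = ENNReal.ofReal ((1 - θ) ^ (-(m * t))) := by
  rcases eq_zero_or_pos t with rfl | ht
  · have : (fun ω ↦ ENNReal.ofReal (Real.exp (θ * γ 0 ω))) =ᵐ[P] fun _ ↦ 1 := by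
      filter_upwards [hγ.zero] with ω hω
      simp [hω]
    rw [lintegral_congr_ae this]
    simp
  · rw [← lintegral_exp_mul_gammaMeasure (by positivity) hθ, ← (hγ.law t ht).map_eq,
      lintegral_map (by fun_prop) (hγ.measurable t)]

/-- Only the marginals are prescribed, not the laws of the increments. Since `γ_t = γ_s + (γ_t -
γ_s)` with independent summands, the transform of the increment is a quotient of two known ones. -/
lemma lintegral_exp_mul_sub (hγ : IsStandardGammaProcess m γ P) (hm : 0 < m) {s t : ℝ≥0}
    (hst : s ≤ t) {θ : ℝ} (hθ : θ < 1) :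
    ∫⁻ ω, ENNReal.ofReal (Real.exp (θ * (γ t ω - γ s ω))) ∂P =
      ENNReal.ofReal ((1 - θ) ^ (-(m * (t - s)))) := by
  have h1 : 0 < 1 - θ := by linarith
  have hs := hγ.measurable s
  have ht := hγ.measurable t
  have hind := hγ.indepIncrements.indepFun_eval_sub (zero_le (a := s)) hst hγ.zero
  have hφ : Measurable fun x : ℝ ↦ ENNReal.ofReal (Real.exp (θ * x)) := by fun_prop
  have hmul := lintegral_mul_eq_lintegral_mul_lintegral_of_indepFun (μ := P)
    (hφ.comp hs) (hφ.comp (ht.sub hs)) (hind.comp hφ hφ)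
  have hprod : ∀ ω, (((fun x : ℝ ↦ ENNReal.ofReal (Real.exp (θ * x))) ∘ γ s) *
      ((fun x : ℝ ↦ ENNReal.ofReal (Real.exp (θ * x))) ∘ (γ t - γ s))) ω =
      ENNReal.ofReal (Real.exp (θ * γ t ω)) := by
    intro ω
    simp only [Pi.mul_apply, Function.comp_apply, Pi.sub_apply]
    rw [← ENNReal.ofReal_mul (Real.exp_pos _).le, ← Real.exp_add]
    ring_nf
  simp_rw [hprod] at hmul
  rw [hγ.lintegral_exp_mul hm t hθ] at hmul
  simp only [Function.comp_apply, Pi.sub_apply] at hmul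
  rw [hγ.lintegral_exp_mul hm s hθ] at hmul
  have hpos : ENNReal.ofReal ((1 - θ) ^ (-(m * s))) ≠ 0 := by
    simpa using Real.rpow_pos_of_pos h1 _
  refine (ENNReal.mul_right_inj hpos ENNReal.ofReal_ne_top).1 (hmul.symm.trans ?_)
  rw [← ENNReal.ofReal_mul (by positivity), ← Real.rpow_add h1]
  ring_nf

omit [IsProbabilityMeasure P] in
lemma ae_pos (hγ : IsStandardGammaProcess m γ P) {t : ℝ≥0} (ht : 0 < t) :
    ∀ᵐ ω ∂P, 0 < γ t ω := by
  have h : ∀ᵐ x ∂(gammaMeasure (m * t) 1), 0 < x := by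
    have hs : MeasurableSet {x : ℝ | ¬ 0 < x} := measurableSet_Ioi.compl
    rw [ae_iff, gammaMeasure, withDensity_apply _ hs]
    have : {x : ℝ | ¬ 0 < x} = Set.Iic 0 := by ext; simp
    rw [this, setLIntegral_congr Iio_ae_eq_Iic.symm]
    exact lintegral_gammaPDF_of_nonpos le_rfl
  rw [← (hγ.law t ht).map_eq] at h
  exact ae_of_ae_map (hγ.measurable t).aemeasurable h

/-- The gamma process up to time `s`, normalized by its value at time `s`, is independent of its
values at time `s` and at later times. -/
theorem indepFun_div (hγ : IsStandardGammaProcess m γ P) (hm : 0 < m) {s t T : ℝ≥0}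
    (hst : s ≤ t) (htT : t ≤ T) (I : Finset ℝ≥0) (hI : ∀ u ∈ I, u ≤ s) :
    IndepFun (fun ω (u : I) ↦ γ u ω / γ s ω) (fun ω ↦ (γ s ω, γ t ω, γ T ω)) P := by
  classical
  have hmeas := hγ.measurable
  -- an increasing enumeration `τ` of the times that are involved
  obtain ⟨N, τ, hτ, hτ0, hτN, hτt, hτT, κ, hκN, hκ⟩ : ∃ (N : ℕ) (τ : ℕ → ℝ≥0), Monotone τ ∧
      τ 0 = 0 ∧ τ N = s ∧ τ (N + 1) = t ∧ τ (N + 2) = T ∧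
      ∃ κ : I → ℕ, (∀ u, κ u ≤ N) ∧ ∀ u : I, τ (κ u) = u := by
    set J : Finset ℝ≥0 := insert 0 (insert s I)
    have h0J : (0 : ℝ≥0) ∈ J := by simp [J]
    have hsJ : s ∈ J := by simp [J]
    have hJs : ∀ u ∈ J, u ≤ s := by
      intro u hu
      simp only [J, Finset.mem_insert] at hu
      rcases hu with rfl | rfl | hu
      exacts [zero_le, le_rfl, hI u hu]
    obtain ⟨N, hN⟩ : ∃ N, J.card = N + 1 :=
      Nat.exists_eq_succ_of_ne_zero (Finset.card_ne_zero_of_mem h0J)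
    let e := J.orderIsoOfFin hN
    have heN : (e (Fin.last N) : ℝ≥0) = s :=
      le_antisymm (hJs _ (e _).2) (by
        obtain ⟨k, hk⟩ := e.surjective ⟨s, hsJ⟩
        have : e k ≤ e (Fin.last N) := e.monotone (Fin.le_last k)
        rw [hk] at this
        exact this)
    have he0 : (e 0 : ℝ≥0) = 0 :=
      le_antisymm (by
        obtain ⟨k, hk⟩ := e.surjective ⟨0, h0J⟩
        have : e 0 ≤ e k := e.monotone (Fin.zero_le k)
        rw [hk] at this
        exact this) zero_le
    -- The constant tail `T` makes `τ` monotone on all of `ℕ`, so that its increments form one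
    -- independent sequence.
    let τ : ℕ → ℝ≥0 := fun k ↦
      if h : k < N + 1 then e ⟨k, h⟩ else if k = N + 1 then t else T
    have hτlt : ∀ k (h : k < N + 1), τ k = e ⟨k, h⟩ := fun k h ↦ dif_pos h
    have hτNv : τ N = s := by rw [hτlt N (by omega)]; exact heN
    have hτ1 : τ (N + 1) = t := by simp [τ]
    have hτ2 : ∀ k, N + 1 < k → τ k = T := fun k hk ↦ by
      simp only [τ]
      rw [dif_neg (by omega), if_neg (by omega)]
    refine ⟨N, τ, monotone_nat_of_le_succ fun k ↦ ?_, ?_, hτNv, hτ1, hτ2 _ (by omega),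
      fun u ↦ (e.symm ⟨u, by simp [J]⟩ : Fin (N + 1)), fun u ↦ ?_, fun u ↦ ?_⟩
    · rcases lt_trichotomy k N with hk | rfl | hk
      · rw [hτlt k (by omega), hτlt (k + 1) (by omega)]
        exact e.monotone (Fin.mk_le_mk.2 (Nat.le_succ k))
      · rw [hτNv, hτ1]; exact hst
      · rcases Nat.lt_or_ge (N + 1) k with hk' | hk'
        · rw [hτ2 k hk', hτ2 (k + 1) (by omega)]
        · obtain rfl : k = N + 1 := by omega
          rw [hτ1, hτ2 _ (by omega)]; exact htT
    · rw [hτlt 0 (by omega)]; exact he0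
    · exact Nat.lt_succ_iff.1 (Fin.is_lt _)
    · rw [hτlt _ (Fin.is_lt _)]; simp
  let D : ℕ → Ω → ℝ := fun i ω ↦ γ (τ (i + 1)) ω - γ (τ i) ω
  have hD : ∀ i, Measurable (D i) := fun i ↦ (hmeas _).sub (hmeas _)
  have hind : iIndepFun D P := hγ.indepIncrements.nat hτ
  have hsum : ∀ k ω, ∑ i ∈ Finset.range k, D i ω = γ (τ k) ω - γ 0 ω := fun k ω ↦ by
    rw [Finset.sum_range_sub (fun i ↦ γ (τ i) ω) k, hτ0]
  -- the past and the future increments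
  let past : Ω → (Finset.range N → ℝ) := fun ω i ↦ D i ω
  have hpast : Measurable past := measurable_pi_lambda _ fun i ↦ hD i
  -- `γ_u / γ_s` written as a partial sum of past increments over their total. If `s = 0` there are
  -- no such increments, and `0 / 0 = 0` agrees with `γ_u / γ_s` almost surely.
  let Φ : (Finset.range N → ℝ) → (I → ℝ) := fun x u ↦
    (∑ i : Finset.range N, if (i : ℕ) < κ u then x i else 0) / ∑ i, x i
  have hΦ : Measurable Φ := by
    refine measurable_pi_lambda _ fun u ↦ Measurable.div ?_ (by fun_prop)
    refine Finset.measurable_sum _ fun i _ ↦ ?_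
    split_ifs <;> fun_prop
  have hΦscale : ∀ k : ℝ, 0 < k → ∀ x, Φ (fun i ↦ k * x i) = Φ x := by
    intro k hk x
    ext u
    have : ∀ i : Finset.range N, (if (i : ℕ) < κ u then k * x i else 0) =
        k * if (i : ℕ) < κ u then x i else 0 := fun i ↦ by split_ifs <;> simp
    simp only [Φ, this, ← Finset.mul_sum]
    exact mul_div_mul_left _ _ hk.ne'
  have hlukacs : IndepFun (fun ω ↦ Φ (past ω)) (fun ω ↦ ∑ i : Finset.range N, D i ω) P :=
    indepFun_sum_of_scale_invariant (D := fun i : Finset.range N ↦ D i) (fun i ↦ hD i)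
      (hind.precomp Subtype.val_injective)
      (b := fun i ↦ m * (τ (i + 1) - τ i))
      (fun i θ hθ ↦ hγ.lintegral_exp_mul_sub hm (hτ (Nat.le_succ _)) hθ) hΦ hΦscale
  have hfut : IndepFun (fun ω (i : ({N, N + 1} : Finset ℕ)) ↦ D i ω) past P :=
    hind.indepFun_finset {N, N + 1} (Finset.range N) (by simp) hD
  have hfut' : IndepFun (fun ω ↦ (D N ω, D (N + 1) ω))
      (fun ω ↦ (Φ (past ω), ∑ i : Finset.range N, D i ω)) P :=
    hfut.comp (φ := fun x : ({N, N + 1} : Finset ℕ) → ℝ ↦ (x ⟨N, by simp⟩, x ⟨N + 1, by simp⟩))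
      (ψ := fun x : Finset.range N → ℝ ↦ (Φ x, ∑ i, x i)) (by fun_prop) (by fun_prop)
  have hall := IndepFun.prodMk_of_indepFun_prodMk (R := fun ω ↦ Φ (past ω))
    (X := fun ω ↦ (D N ω, D (N + 1) ω)) (W := fun ω ↦ ∑ i : Finset.range N, D i ω)
    (hΦ.comp hpast) ((hD _).prodMk (hD _)) (Finset.measurable_sum _ fun i _ ↦ hD i)
    hlukacs hfut'
  have hfinal := hall.comp (φ := id)
    (ψ := fun p : (ℝ × ℝ) × ℝ ↦ (p.2, p.2 + p.1.1, p.2 + p.1.1 + p.1.2)) measurable_id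
    (by fun_prop)
  have hS : ∀ ω, ∑ i : Finset.range N, D i ω = γ s ω - γ 0 ω := fun ω ↦ by
    rw [Finset.sum_coe_sort (Finset.range N) (fun i ↦ D i ω), hsum, hτN]
  refine hfinal.congr ?_ ?_
  · filter_upwards [hγ.zero] with ω hω
    ext u
    simp only [Function.comp_apply, id, Φ, past]
    rw [hS, Finset.sum_coe_sort (Finset.range N) (fun i ↦ if i < κ u then D i ω else 0),
      ← Finset.sum_filter]
    have : (Finset.range N).filter (· < κ u) = Finset.range (κ u) := by
      ext i
      have := hκN u
      simp only [Finset.mem_filter, Finset.mem_range]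
      omega
    rw [this, hsum, hκ, hω, sub_zero, sub_zero]
  · filter_upwards [hγ.zero] with ω hω
    simp only [Function.comp_apply, hS, D, hτN, hτt, hτT, hω]
    simp

end IsStandardGammaProcess

/-! ### Gamma bridges -/

namespace IsStandardGammaBridge

variable {Ω : Type*} {mΩ : MeasurableSpace Ω} {P : Measure Ω} [IsProbabilityMeasure P]
  {m : ℝ} {T : ℝ≥0} {Y : Set.Icc (0 : ℝ≥0) T → Ω → ℝ}

omit [IsProbabilityMeasure P] in
lemma ae_ne_zero (hY : IsStandardGammaBridge m T Y P) {s : Set.Icc (0 : ℝ≥0) T}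
    (hs : (0 : ℝ≥0) < s) : ∀ᵐ ω ∂P, Y s ω ≠ 0 := by
  obtain ⟨Ω', _, P', γ, _, hγ, hid⟩ := hY.law
  have h := hid.comp (u := fun x : Set.Icc (0 : ℝ≥0) T → ℝ ↦ x s) (by fun_prop)
  refine h.symm.ae_snd (p := fun x ↦ x ≠ 0) (measurableSet_singleton 0).compl ?_
  filter_upwards [hγ.ae_pos hs, hγ.ae_pos (hs.trans_le s.2.2)] with ω h1 h2
  exact div_ne_zero h1.ne' h2.ne'

/-- The gamma bridge up to time `s`, normalized by its value at time `s`, is independent of its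
values at time `s` and at a later time. -/
theorem indepFun_div (hY : IsStandardGammaBridge m T Y P) (hm : 0 < m) (hT : 0 < T)
    {s t : Set.Icc (0 : ℝ≥0) T} (hst : s ≤ t) (I : Finset (Set.Iic s)) :
    IndepFun (fun ω (u : I) ↦ Y (u : Set.Iic s) ω / Y s ω) (fun ω ↦ (Y s ω, Y t ω)) P := by
  classical
  obtain ⟨Ω', _, P', γ, _, hγ, hid⟩ := hY.law
  have h := hγ.indepFun_div hm (s := s) (t := t) (T := T) hst t.2.2
    (I.image fun u : Set.Iic s ↦ ((u : Set.Icc (0 : ℝ≥0) T) : ℝ≥0)) (by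
      simp only [Finset.mem_image]
      rintro _ ⟨u, -, rfl⟩
      exact u.2)
  have h' := h.comp (φ := fun x (u : I) ↦ x ⟨((u : Set.Iic s) : Set.Icc (0 : ℝ≥0) T),
      Finset.mem_image_of_mem (fun u : Set.Iic s ↦ ((u : Set.Icc (0 : ℝ≥0) T) : ℝ≥0)) u.2⟩)
    (ψ := fun p ↦ (p.1 / p.2.2, p.2.1 / p.2.2))
    (by fun_prop) (by fun_prop)
  have hbridge : IndepFun
      (fun ω (u : I) ↦ γ (u : Set.Iic s) ω / γ T ω / (γ s ω / γ T ω))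
      (fun ω ↦ (γ s ω / γ T ω, γ t ω / γ T ω)) P' := by
    refine h'.congr ?_ .rfl
    filter_upwards [hγ.ae_pos hT] with ω hω
    ext u
    exact (div_div_div_cancel_right₀ hω.ne' _ _).symm
  -- Independence depends only on the joint law, so it passes from the quotient process to `Y`.
  have hid' := hid.comp (u := fun x ↦ ((fun u : I ↦ x (u : Set.Iic s) / x s), (x s, x t)))
    (by fun_prop)
  have hYm := hY.measurable
  have hγm := hγ.measurable
  rw [indepFun_iff_map_prod_eq_prod_map_map (by fun_prop) (by fun_prop)] at hbridge ⊢
  have e0 := hid'.map_eq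
  have e1 := (hid'.comp measurable_fst).map_eq
  have e2 := (hid'.comp measurable_snd).map_eq
  simp only [Function.comp_def] at e0 e1 e2
  rw [e0, e1, e2, hbridge]

end IsStandardGammaBridge

/-! ### Discarding independent factors in a conditional expectation -/

/-- If a process `Z` factors as `Z u = S * R u` almost surely, where the finite families of the
`R u` are independent of `(S, V)`, then conditioning `V` on `Z` amounts to conditioning it
on `S`. -/
theorem condExp_iSup_comap_ae_eq_of_indepFun {Ω ι β : Type*} [mΩ : MeasurableSpace Ω]
    [MeasurableSpace β] {P : Measure Ω} [IsProbabilityMeasure P] {Z R : ι → Ω → ℝ} {S : Ω → ℝ}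
    {V : Ω → β} (hZ : ∀ u, Measurable (Z u)) (hR : ∀ u, Measurable (R u)) (hS : Measurable S)
    (hV : Measurable V) (hZR : ∀ u, Z u =ᵐ[P] fun ω ↦ S ω * R u ω)
    (hind : ∀ I : Finset ι, IndepFun (fun ω (u : I) ↦ R u ω) (fun ω ↦ (S ω, V ω)) P)
    (hSZ : MeasurableSpace.comap S inferInstance ≤
      ⨆ u, MeasurableSpace.comap (Z u) inferInstance)
    {B : Set β} (hB : MeasurableSet B) :
    P⟦V ⁻¹' B | ⨆ u, MeasurableSpace.comap (Z u) inferInstance⟧ =ᵐ[P]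
      P⟦V ⁻¹' B | MeasurableSpace.comap S inferInstance⟧ := by
  have hVB : MeasurableSet (V ⁻¹' B) := hV hB
  have hmS : MeasurableSpace.comap S inferInstance ≤ mΩ := hS.comap_le
  have hmZ : (⨆ u, MeasurableSpace.comap (Z u) inferInstance) ≤ mΩ :=
    iSup_le fun u ↦ (hZ u).comap_le
  set g : Ω → ℝ := P⟦V ⁻¹' B | MeasurableSpace.comap S inferInstance⟧ with hg
  have hgS : Measurable[MeasurableSpace.comap S inferInstance] g :=
    stronglyMeasurable_condExp.measurable
  have hgm : Measurable g := hgS.mono hmS le_rfl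
  have hgint : Integrable g P := integrable_condExp
  have hint : Integrable ((V ⁻¹' B).indicator fun _ ↦ (1 : ℝ)) P :=
    (integrable_const 1).indicator hVB
  have hg0 : 0 ≤ᵐ[P] g := condExp_nonneg (Filter.Eventually.of_forall fun ω ↦
    Set.indicator_nonneg (fun _ _ ↦ zero_le_one) ω)
  have hgfin : IsFiniteMeasure (P.withDensity fun ω ↦ ENNReal.ofReal (g ω)) :=
    isFiniteMeasure_withDensity_ofReal hgint.2
  -- the defining property of `g`, as an equality of lower integrals
  have hgset : ∀ A, MeasurableSet[MeasurableSpace.comap S inferInstance] A →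
      ∫⁻ ω in A, ENNReal.ofReal (g ω) ∂P = P (A ∩ V ⁻¹' B) := by
    intro A hA
    rw [← ofReal_integral_eq_lintegral_ofReal hgint.integrableOn (ae_restrict_of_ae hg0),
      setIntegral_condExp hmS hint hA, integral_indicator hVB, setIntegral_const, smul_eq_mul,
      mul_one, measureReal_restrict_apply hVB, ofReal_measureReal, Set.inter_comm]
  -- Weighting `P` by the indicator of `V ∈ B` or by `g` gives `(R, S)` the same law: on a rectangle
  -- the `R` factor splits off by independence, and the `S` factor is `hgset`.
  have hjoint : ∀ I : Finset ι,
      (P.restrict (V ⁻¹' B)).map (fun ω ↦ ((fun u : I ↦ R u ω), S ω)) =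
        (P.withDensity fun ω ↦ ENNReal.ofReal (g ω)).map (fun ω ↦ ((fun u : I ↦ R u ω), S ω)) := by
    intro I
    have hRI : Measurable fun ω (u : I) ↦ R u ω := by fun_prop
    refine Measure.ext_prod fun {C A} hC hA ↦ ?_
    have hpre : (fun ω ↦ ((fun u : I ↦ R u ω), S ω)) ⁻¹' C ×ˢ A =
      (fun ω (u : I) ↦ R u ω) ⁻¹' C ∩ S ⁻¹' A := by ext; simp
    rw [Measure.map_apply (by fun_prop) (hC.prod hA), Measure.map_apply (by fun_prop) (hC.prod hA),
      hpre, Measure.restrict_apply ((hRI hC).inter (hS hA)),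
      withDensity_apply _ ((hRI hC).inter (hS hA)), Set.inter_assoc]
    have h1 := indepFun_iff_measure_inter_preimage_eq_mul.1 (hind I) C (A ×ˢ B) hC (hA.prod hB)
    have e1 : (fun ω ↦ (S ω, V ω)) ⁻¹' A ×ˢ B = S ⁻¹' A ∩ V ⁻¹' B := by ext; simp
    rw [e1] at h1
    rw [h1, ← lintegral_indicator ((hRI hC).inter (hS hA))]
    have hRS : IndepFun (fun ω (u : I) ↦ R u ω) S P := (hind I).comp measurable_id measurable_fst
    have hmul : ∀ ω, ((fun ω (u : I) ↦ R u ω) ⁻¹' C ∩ S ⁻¹' A).indicator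
        (fun ω ↦ ENNReal.ofReal (g ω)) ω =
        ((fun ω (u : I) ↦ R u ω) ⁻¹' C).indicator 1 ω *
          (S ⁻¹' A).indicator (fun ω ↦ ENNReal.ofReal (g ω)) ω := by
      intro ω
      by_cases h : ω ∈ (fun ω (u : I) ↦ R u ω) ⁻¹' C <;> by_cases h' : ω ∈ S ⁻¹' A <;>
        simp [Set.indicator, h, h']
    simp_rw [hmul]
    rw [lintegral_mul_eq_lintegral_mul_lintegral_of_independent_measurableSpace hRI.comap_le
      hmS hRS (f := ((fun ω (u : I) ↦ R u ω) ⁻¹' C).indicator 1)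
      (g := (S ⁻¹' A).indicator fun ω ↦ ENNReal.ofReal (g ω))
      (Measurable.indicator (@measurable_const _ _ _ (MeasurableSpace.comap _ _) 1) ⟨C, hC, rfl⟩)
      ((ENNReal.measurable_ofReal.comp hgS).indicator ⟨A, hA, rfl⟩),
      lintegral_indicator_one (hRI hC), lintegral_indicator (hS hA), hgset _ ⟨A, hA, rfl⟩]
  have hpath : (P.restrict (V ⁻¹' B)).map (fun ω u ↦ Z u ω) =
      (P.withDensity fun ω ↦ ENNReal.ofReal (g ω)).map (fun ω u ↦ Z u ω) := by
    have hZm : Measurable fun ω u ↦ Z u ω := measurable_pi_lambda _ hZ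
    -- Finite-dimensional marginals determine a finite measure on path space, even for uncountable
    -- `ι`.
    refine (isProjectiveLimit_map hZm.aemeasurable).unique fun I ↦ ?_
    rw [Measure.map_map (by fun_prop) hZm]
    have hae : ∀ κ : Measure Ω, κ ≪ P → κ.map (fun ω (u : I) ↦ Z u ω) =
        (κ.map (fun ω ↦ ((fun u : I ↦ R u ω), S ω))).map (fun p u ↦ p.2 * p.1 u) := by
      intro κ hκ
      rw [Measure.map_map (by fun_prop) (by fun_prop)]
      refine Measure.map_congr (hκ.ae_le ?_)
      filter_upwards [ae_all_iff.2 fun u : I ↦ hZR u] with ω hω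
      ext u
      exact hω u
    exact (hae _ (withDensity_absolutelyContinuous _ _)).trans
      ((congrArg _ (hjoint I).symm).trans (hae _ Measure.restrict_le_self.absolutelyContinuous).symm)
  refine (ae_eq_condExp_of_forall_setIntegral_eq hmZ hint (fun _ _ _ ↦ hgint.integrableOn)
    (fun A hA _ ↦ ?_) (hgS.mono hSZ le_rfl).aestronglyMeasurable).symm
  have hcomap : (⨆ u, MeasurableSpace.comap (Z u) inferInstance) =
      MeasurableSpace.comap (fun ω u ↦ Z u ω) inferInstance := by
    change _ = MeasurableSpace.comap _ (⨆ u, MeasurableSpace.comap (fun x : ι → ℝ ↦ x u) _)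
    simp only [MeasurableSpace.comap_iSup, MeasurableSpace.comap_comp]
    rfl
  rw [hcomap] at hA
  obtain ⟨C, hC, rfl⟩ := hA
  have hZm : Measurable fun ω u ↦ Z u ω := measurable_pi_lambda _ hZ
  have h := congrArg (fun μ ↦ μ C) hpath
  rw [Measure.map_apply hZm hC, Measure.map_apply hZm hC, Measure.restrict_apply (hZm hC),
    withDensity_apply _ (hZm hC)] at h
  rw [integral_eq_lintegral_of_nonneg_ae (ae_restrict_of_ae hg0) hgm.aestronglyMeasurable, ← h,
    integral_indicator hVB, setIntegral_const, smul_eq_mul, mul_one]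
  simp [Measure.real, hVB, Set.inter_comm]

/-! ### The Markov property -/

theorem proposition4 {Ω : Type*} [MeasurableSpace Ω] (P : Measure Ω) [IsProbabilityMeasure P]
    (m : ℝ) (hm : 0 < m) (T : ℝ≥0) (hT : 0 < T)
    (X : Ω → ℝ) (hX : Measurable X) (hXpos : ∀ᵐ ω ∂P, 0 < X ω)
    (Y : Set.Icc (0 : ℝ≥0) T → Ω → ℝ) (hY : IsStandardGammaBridge m T Y P)
    (hXY : IndepFun X (fun ω t ↦ Y t ω) P)
    (ξ : Set.Icc (0 : ℝ≥0) T → Ω → ℝ) (hξm : ∀ t, Measurable (ξ t))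
    (hξ : ∀ t, ξ t =ᵐ[P] fun ω ↦ X ω * Y t ω) :
    HasMarkovProperty ξ (Filtration.natural ξ (fun t ↦ (hξm t).stronglyMeasurable)) P := by
  refine ⟨fun t ↦ ?_, fun s t hst B hB ↦ ?_⟩
  · exact (comap_measurable (ξ t)).mono
      (le_iSup₂ (f := fun j (_ : j ≤ t) ↦ MeasurableSpace.comap (ξ j) inferInstance) t le_rfl)
      le_rfl
  have hfilt : Filtration.natural ξ (fun t ↦ (hξm t).stronglyMeasurable) s =
      ⨆ u : Set.Iic s, MeasurableSpace.comap (ξ u) inferInstance :=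
    iSup_subtype' (f := fun j (_ : j ≤ s) ↦ MeasurableSpace.comap (ξ j) inferInstance)
  rw [hfilt]
  have hle : MeasurableSpace.comap (ξ s) inferInstance ≤
      ⨆ u : Set.Iic s, MeasurableSpace.comap (ξ u) inferInstance :=
    le_iSup (fun u : Set.Iic s ↦ MeasurableSpace.comap (ξ u) inferInstance) ⟨s, le_refl s⟩
  -- At `s = 0` the ratios degenerate, but there the past consists of `ξ_0` alone.
  rcases eq_zero_or_pos (s : ℝ≥0) with hs | hs
  · have hge : ⨆ u : Set.Iic s, MeasurableSpace.comap (ξ u) inferInstance ≤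
        MeasurableSpace.comap (ξ s) inferInstance := by
      refine iSup_le fun u ↦ ?_
      have : (u : Set.Icc (0 : ℝ≥0) T) = s := by
        refine le_antisymm u.2 (Subtype.coe_le_coe.1 ?_)
        rw [hs]
        exact zero_le
      rw [this]
    rw [le_antisymm hge hle]
  · have hYm := hY.measurable
    refine condExp_iSup_comap_ae_eq_of_indepFun (Z := fun u : Set.Iic s ↦ ξ u)
      (R := fun u ω ↦ ξ u ω / ξ s ω) (fun u ↦ hξm u) (fun u ↦ (hξm u).div (hξm s)) (hξm s) (hξm t)
      (fun u ↦ ?_) (fun I ↦ ?_) hle hB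
    · filter_upwards [hξ s, hXpos, hY.ae_ne_zero hs] with ω h1 h2 h3
      have : ξ s ω ≠ 0 := by rw [h1]; exact mul_ne_zero h2.ne' h3
      field_simp
    · have h := IndepFun.prodMk_of_indepFun_prodMk
        (R := fun ω (u : I) ↦ Y (u : Set.Iic s) ω / Y s ω) (W := fun ω ↦ (Y s ω, Y t ω))
        (by fun_prop) hX (by fun_prop) (hY.indepFun_div hm hT hst I)
        (hXY.comp (φ := id)
          (ψ := fun y : Set.Icc (0 : ℝ≥0) T → ℝ ↦ ((fun u : I ↦ y (u : Set.Iic s) / y s), y s, y t))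
          measurable_id (by fun_prop))
      have h' := h.comp (φ := id)
        (ψ := fun p : ℝ × ℝ × ℝ ↦ (p.1 * p.2.1, p.1 * p.2.2)) measurable_id (by fun_prop)
      refine h'.congr ?_ ?_
      · filter_upwards [hXpos, hξ s, ae_all_iff.2 fun u : I ↦ hξ (u : Set.Iic s)] with ω h1 h2 h3
        ext u
        simp only [Function.comp_apply, id, h2, h3]
        rw [mul_div_mul_left _ _ h1.ne']
      · filter_upwards [hξ s, hξ t] with ω h1 h2
        simp [h1, h2]
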